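/- Let $R\to A$ be a homomorphism of commutative Noetherian rings, let $I\subseteq A$ be an ideal such that $A/I$ is a finitely generated $R$-module, and let $M$ be a finitely generated $A$-module. For $\mathfrak p\in\operatorname{Spec}R$ let $k(\mathfrak p)$ be its residue field and put $A(\mathfrak p)=k(\mathfrak p)\otimes_R A$, $I(\mathfrak p)=IA(\mathfrak p)$ and $M(\mathfrak p)=k(\mathfrak p)\otimes_R M$; write $I^nM(\mathfrak p)=I(\mathfrak p)^nM(\mathfrak p)$. A function $f$ from a topological space $X$ to a partially ordered set $\Lambda$ is called upper semicontinuous if $\{x\in X : f(x)<\lambda\}$ is open for every $\lambda\in\Lambda$. Then all the vector spaces $M(\mathfrak p)/I^nM(\mathfrak p)$ are finite-dimensional over $k(\mathfrak p)$, and the following functions on $\operatorname{Spec}R$ are upper semicontinuous: 1. $\mathfrak p\mapsto \dim_{k(\mathfrak p)} M(\mathfrak p)/I^nM(\mathfrak p)$, for every $n\ge 0$; 2. $\mathfrak p\mapsto \bigl(\dim_{k(\mathfrak p)} M(\mathfrak p)/IM(\mathfrak p),\ \dim_{k(\mathfrak p)} M(\mathfrak p)/I^2M(\mathfrak p),\ \ldots\bigr)$,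 with values in the sequences of natural numbers ordered lexicographically; 3. if there is an integer $d\ge 0$ such that the $A(\mathfrak p)$-module $M(\mathfrak p)$ has Krull dimension $d$ for every $\mathfrak p\in\operatorname{Spec}R$: the Hilbert–Samuel multiplicity $$\mathfrak p\mapsto e(I(\mathfrak p),M(\mathfrak p))=\lim_{n\to\infty}\frac{d!\,\dim_{k(\mathfrak p)} M(\mathfrak p)/I^nM(\mathfrak p)}{n^d},$$ where the limit exists in $\mathbb R$ for every $\mathfrak p$. -/

import Mathlib

namespace HilbertSamuel

open scoped TensorProduct Nat

/-- The Krull dimension of (the support of) the `B`-module `N`, as a natural number; this is used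
only for modules whose dimension is a natural number. -/
noncomputable def natDim (B : Type*) [CommRing B] (N : Type*) [AddCommGroup N] [Module B N] : ℕ :=
  ((Module.supportDim B N).unbotD 0).toNat

/-- The Hilbert–Samuel function `n ↦ dim_K (N / JⁿN)` of an ideal `J` in a `K`-algebra `B` and a
`B`-module `N`. -/
noncomputable def hsFunction (K : Type*) {B : Type*} [Field K] [CommRing B] [Algebra K B]
    (J : Ideal B) (N : Type*) [AddCommGroup N] [Module K N] [Module B N] [IsScalarTower K B N]
    (n : ℕ) : ℕ :=
  Module.finrank K (N ⧸ (J ^ n • ⊤ : Submodule B N))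

/-- The terms `d! · dim_K (N / JⁿN) / n ^ d`, where `d = dim N`, whose limit is the
Hilbert–Samuel multiplicity. -/
noncomputable def hsTerm (K : Type*) {B : Type*} [Field K] [CommRing B] [Algebra K B]
    (J : Ideal B) (N : Type*) [AddCommGroup N] [Module K N] [Module B N] [IsScalarTower K B N]
    (n : ℕ) : ℝ :=
  ((natDim B N)! : ℝ) * (hsFunction K J N n : ℝ) / (n : ℝ) ^ natDim B N

/-- The Hilbert–Samuel multiplicity `e(J, N) = lim d! · dim_K (N / JⁿN) / n ^ d`, `d = dim N`. -/
noncomputable def hsMultiplicity (K : Type*) {B : Type*} [Field K] [CommRing B] [Algebra K B]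
    (J : Ideal B) (N : Type*) [AddCommGroup N] [Module K N] [Module B N]
    [IsScalarTower K B N] : ℝ :=
  Filter.limUnder Filter.atTop (hsTerm K J N)

section Fiber

variable {R : Type*} [CommRing R] (p : PrimeSpectrum R)

/-- The fibre ring `A(p) = k(p) ⊗_R A`, where `k(p)` is the residue field of `p`. -/
abbrev fiberRing (A : Type*) [CommRing A] [Algebra R A] : Type _ :=
  p.asIdeal.ResidueField ⊗[R] A

/-- The ideal `I(p) = I A(p)` of `A(p)`. -/
noncomputable def fiberIdeal {A : Type*} [CommRing A] [Algebra R A] (I : Ideal A) :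
    Ideal (fiberRing p A) :=
  I.map (Algebra.TensorProduct.includeRight : A →ₐ[R] fiberRing p A)

/-- The fibre `M(p) = k(p) ⊗_R M`. It is a type synonym, so that its structure of `A(p)`-module
defined below does not interfere with the standard instances on tensor products. -/
def fiberModule (M : Type*) [AddCommGroup M] [Module R M] : Type _ :=
  p.asIdeal.ResidueField ⊗[R] M

noncomputable instance (M : Type*) [AddCommGroup M] [Module R M] :
    AddCommGroup (fiberModule p M) :=
  inferInstanceAs (AddCommGroup (p.asIdeal.ResidueField ⊗[R] M))

noncomputable instance (M : Type*) [AddCommGroup M] [Module R M] :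
    Module p.asIdeal.ResidueField (fiberModule p M) :=
  inferInstanceAs (Module p.asIdeal.ResidueField (p.asIdeal.ResidueField ⊗[R] M))

/-- The action of `A(p)` on `M(p)`, given by `(c ⊗ a) • (c' ⊗ m) = c c' ⊗ a m`. -/
noncomputable def fiberAction (A : Type*) [CommRing A] [Algebra R A]
    (M : Type*) [AddCommGroup M] [Module R M] [Module A M] [IsScalarTower R A M] :
    fiberRing p A →ₐ[p.asIdeal.ResidueField]
      Module.End p.asIdeal.ResidueField (p.asIdeal.ResidueField ⊗[R] M) :=
  Algebra.TensorProduct.lift (Algebra.ofId p.asIdeal.ResidueField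
      (Module.End p.asIdeal.ResidueField (p.asIdeal.ResidueField ⊗[R] M)))
    ((Module.End.baseChangeHom R p.asIdeal.ResidueField M).comp (Algebra.lsmul R R M))
    (fun c _ => Algebra.commutes c _)

noncomputable instance (A : Type*) [CommRing A] [Algebra R A]
    (M : Type*) [AddCommGroup M] [Module R M] [Module A M] [IsScalarTower R A M] :
    Module (fiberRing p A) (fiberModule p M) :=
  Module.compHom (p.asIdeal.ResidueField ⊗[R] M) (fiberAction p A M).toRingHom

instance (A : Type*) [CommRing A] [Algebra R A]
    (M : Type*) [AddCommGroup M] [Module R M] [Module A M] [IsScalarTower R A M] :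
    IsScalarTower p.asIdeal.ResidueField (fiberRing p A) (fiberModule p M) where
  smul_assoc c x m := by
    change fiberAction p A M (c • x) m = c • fiberAction p A M x m
    rw [map_smul]
    rfl

theorem fiberAction_tmul (A : Type*) [CommRing A] [Algebra R A]
    (M : Type*) [AddCommGroup M] [Module R M] [Module A M] [IsScalarTower R A M]
    (c c' : p.asIdeal.ResidueField) (a : A) (m : M) :
    fiberAction p A M (c ⊗ₜ[R] a) (c' ⊗ₜ[R] m) = (c * c') ⊗ₜ[R] (a • m) :=
  rfl

end Fiber

end HilbertSamuel

open HilbertSamuel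

/-! Since `A` is Noetherian and `A ⧸ I` is finite over `R`, every `M/IⁿM` is a finite `R`-module,
and its fibre at `p` is `M(p)/IⁿM(p)`. Each term is therefore the fibre dimension of a finite
module, upper semicontinuous by Nakayama. The lexicographic statement follows because a strict
inequality is decided by finitely many terms.

The multiplicity is a limit, so termwise openness does not suffice: one open set must serve all `n`.
The key (`exists_hsFunction_fiber_eq`) is that for each prime `q` the whole Hilbert–Samuel function
is constant on `V(q) ∩ D(f)` for a single `f ∉ q`. This is generic freeness over `R ⧸ q` of the
graded module of `M/qM` with respect to `I`, proved here by induction on the number of generators of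
`I` (`uniformlyGenericallyFree_of_le_sup_span`). Multiplication by one generator is made injective
by removing its torsion, and both the torsion and the cokernel need one generator less. The same
induction shows the ranks to be eventually polynomial in the degree.

Multiplicities can only drop under generization, as limits of functions that do. Constancy on `V(q)
∩ D(f)` then gives openness in a Noetherian spectrum (`isOpen_of_forall_le_of_forall_exists`). The
limit exists because the function is eventually polynomial and is `O(n^d)` with `d = dim M(p)`; that
bound comes from dévissage to `B/P` and cutting by an element of `J` outside `P`. -/

namespace HilbertSamuel

open scoped TensorProduct Pointwise

/-! ### Eventually polynomial functions and their limits -/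

section Polynomial

open Polynomial Filter

/-- A sequence of natural numbers that agrees with a real polynomial for large arguments. -/
def EventuallyPolynomial (h : ℕ → ℕ) : Prop :=
  ∃ P : ℝ[X], ∀ᶠ n : ℕ in atTop, (h n : ℝ) = P.eval (n : ℝ)

theorem EventuallyPolynomial.add {g h : ℕ → ℕ} (hg : EventuallyPolynomial g)
    (hh : EventuallyPolynomial h) : EventuallyPolynomial fun n => g n + h n := by
  obtain ⟨P, hP⟩ := hg
  obtain ⟨Q, hQ⟩ := hh
  refine ⟨P + Q, ?_⟩
  filter_upwards [hP, hQ] with n h₁ h₂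
  rw [Nat.cast_add, h₁, h₂, eval_add]

theorem EventuallyPolynomial.of_eventually_eq_zero {h : ℕ → ℕ} (N : ℕ)
    (hN : ∀ n ≥ N, h n = 0) : EventuallyPolynomial h :=
  ⟨0, (eventually_ge_atTop N).mono fun n hn => by simp [hN n hn]⟩

/-- By linearity this reduces to monomials, where Faulhaber's formula applies. -/
theorem exists_polynomial_sum_range (P : ℝ[X]) :
    ∃ Q : ℝ[X], ∀ n : ℕ, ∑ i ∈ Finset.range n, P.eval (i : ℝ) = Q.eval (n : ℝ) := by
  induction P using Polynomial.induction_on' with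
  | add P P' h h' =>
    obtain ⟨Q, hQ⟩ := h
    obtain ⟨Q', hQ'⟩ := h'
    exact ⟨Q + Q', fun n => by simp [Finset.sum_add_distrib, hQ, hQ']⟩
  | monomial p a =>
    refine ⟨C (a / (p + 1)) * ((Polynomial.bernoulli p.succ).map (algebraMap ℚ ℝ) -
      C (algebraMap ℚ ℝ (_root_.bernoulli p.succ))), fun n => ?_⟩
    have h := congrArg (algebraMap ℚ ℝ) (sum_range_pow_eq_bernoulli_sub n p)
    have h₁ : algebraMap ℚ ℝ ((Polynomial.bernoulli p.succ).eval (n : ℚ)) =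
        ((Polynomial.bernoulli p.succ).map (algebraMap ℚ ℝ)).eval (n : ℝ) := by
      rw [← map_natCast (algebraMap ℚ ℝ) n, Polynomial.eval_map_algebraMap,
        Polynomial.aeval_algebraMap_apply, Polynomial.coe_aeval_eq_eval]
    rw [map_sub, h₁, map_mul, map_sum] at h
    simp only [map_add, map_natCast, map_one, map_pow] at h
    simp only [eval_mul, eval_sub, eval_C, eval_monomial, ← Finset.mul_sum]
    rw [← h]
    have : (p : ℝ) + 1 ≠ 0 := by positivity
    field_simp

theorem EventuallyPolynomial.sum_range {h : ℕ → ℕ} (hh : EventuallyPolynomial h) :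
    EventuallyPolynomial fun n => ∑ i ∈ Finset.range n, h i := by
  obtain ⟨P, hP⟩ := hh
  obtain ⟨N, hN⟩ := eventually_atTop.1 hP
  obtain ⟨Q, hQ⟩ := exists_polynomial_sum_range P
  refine ⟨Q + C (∑ i ∈ Finset.range N, ((h i : ℝ) - P.eval (i : ℝ))), ?_⟩
  filter_upwards [eventually_ge_atTop N] with n hn
  have h₁ : ∑ i ∈ Finset.range n, ((h i : ℝ) - P.eval (i : ℝ)) =
      ∑ i ∈ Finset.range N, ((h i : ℝ) - P.eval (i : ℝ)) := by
    refine (Finset.sum_subset (Finset.range_mono hn) fun i _ hi => ?_).symm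
    rw [hN i (by simpa using hi), sub_self]
  rw [eval_add, eval_C, ← hQ, ← h₁, Finset.sum_sub_distrib]
  push_cast
  ring

theorem EventuallyPolynomial.comp_succ {h : ℕ → ℕ} (hh : EventuallyPolynomial h) :
    EventuallyPolynomial fun n => h (n + 1) := by
  obtain ⟨P, hP⟩ := hh
  refine ⟨P.comp (X + 1), ?_⟩
  filter_upwards [(tendsto_add_atTop_nat 1).eventually hP] with n hn
  simpa using hn

/-- The bound forces the polynomial to have degree at most `d`, since otherwise the quotient would
be unbounded; the limit is its coefficient in degree `d`. -/
theorem EventuallyPolynomial.exists_tendsto {h : ℕ → ℕ} (hh : EventuallyPolynomial h) {d : ℕ}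
    {c : ℝ} (hc : ∀ n : ℕ, (h n : ℝ) ≤ c * ((n : ℝ) + 1) ^ d) :
    ∃ e : ℝ, Tendsto (fun n : ℕ => (h n : ℝ) / (n : ℝ) ^ d) atTop (nhds e) := by
  obtain ⟨P, hP⟩ := hh
  have hcongr : (fun n : ℕ => P.eval (n : ℝ) / ((X : ℝ[X]) ^ d).eval (n : ℝ)) =ᶠ[atTop]
      fun n : ℕ => (h n : ℝ) / (n : ℝ) ^ d := by
    filter_upwards [hP] with n hn
    simp [hn]
  have hcast : Tendsto (fun n : ℕ => (n : ℝ)) atTop atTop := tendsto_natCast_atTop_atTop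
  rcases lt_trichotomy P.degree ((X : ℝ[X]) ^ d).degree with hlt | heq | hgt
  · exact ⟨_, ((div_tendsto_atTop_zero_of_degree_lt _ _ hlt).comp hcast).congr' hcongr⟩
  · exact ⟨_, ((div_tendsto_atTop_leadingCoeff_div_of_degree_eq _ _ heq).comp hcast).congr' hcongr⟩
  · exfalso
    have h₁ : Tendsto (fun n : ℕ => |(h n : ℝ) / (n : ℝ) ^ d|) atTop atTop :=
      ((abs_div_tendsto_atTop_atTop_of_degree_gt _ _ hgt (by simp)).comp hcast).congr'
        (hcongr.fun_comp abs)
    refine not_tendsto_const_atTop (|c| * 2 ^ d) (atTop : Filter ℕ)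
      (tendsto_atTop_mono' _ ?_ h₁)
    filter_upwards [eventually_ge_atTop 1] with n hn
    have hn' : (1 : ℝ) ≤ n := by exact_mod_cast hn
    rw [abs_of_nonneg (by positivity), div_le_iff₀ (by positivity), mul_assoc, ← mul_pow]
    calc (h n : ℝ) ≤ c * ((n : ℝ) + 1) ^ d := hc n
      _ ≤ |c| * (2 * (n : ℝ)) ^ d := by
        gcongr
        · exact le_abs_self c
        · linarith

end Polynomial

/-! ### Generic freeness of a subquotient -/

section GenericallyFree

variable {R M M' : Type*} [CommRing R] [AddCommGroup M] [Module R M] [AddCommGroup M'] [Module R M']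

/-- The quotient `V / U` is free of rank `h` over `R ⧸ q` after inverting `f`, expressed by a family
in `V` that is independent modulo `q` and `U`, and generates `V` modulo `U` up to powers of `f`. -/
def GenericallyFree (q : Ideal R) (f : R) (h : ℕ) (U V : Submodule R M) : Prop :=
  ∃ b : Fin h → M, (∀ i, b i ∈ V) ∧ (∀ c : Fin h → R, ∑ i, c i • b i ∈ U → ∀ i, c i ∈ q) ∧
    ∀ x ∈ V, ∃ k : ℕ, f ^ k • x ∈ U ⊔ Submodule.span R (Set.range b)

namespace GenericallyFree

variable {q : Ideal R} {f g : R} {h h' : ℕ} {U V W : Submodule R M}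

theorem of_le (hVU : V ≤ U) : GenericallyFree q f 0 U V :=
  ⟨Fin.elim0, fun i => i.elim0, fun _ _ i => i.elim0, fun x hx => ⟨0, by
    rw [pow_zero, one_smul]; exact Submodule.mem_sup_left (hVU hx)⟩⟩

theorem of_dvd (H : GenericallyFree q f h U V) (hfg : f ∣ g) : GenericallyFree q g h U V := by
  obtain ⟨b, hb, hi, hs⟩ := H
  obtain ⟨r, rfl⟩ := hfg
  refine ⟨b, hb, hi, fun x hx => ?_⟩
  obtain ⟨k, hk⟩ := hs x hx
  exact ⟨k, by rw [mul_comm, mul_pow, mul_smul]; exact Submodule.smul_mem _ _ hk⟩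

/-- Families for `W / U` and `V / W` are concatenated. As independence holds only modulo `q`, the
hypothesis `hq` is what discards the terms of the second family once their coefficients lie in `q`.
-/
theorem trans (H : GenericallyFree q f h U W) (H' : GenericallyFree q f h' W V) (hUW : U ≤ W)
    (hWV : W ≤ V) (hq : ∀ r ∈ q, ∀ x ∈ V, r • x ∈ U) : GenericallyFree q f (h + h') U V := by
  obtain ⟨b, hb, hi, hs⟩ := H
  obtain ⟨b', hb', hi', hs'⟩ := H'
  refine ⟨Fin.append b b', fun i => ?_, fun c hc => ?_, fun x hx => ?_⟩
  · refine Fin.addCases (fun i => ?_) (fun i => ?_) i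
    · rw [Fin.append_left]; exact hWV (hb i)
    · rw [Fin.append_right]; exact hb' i
  · simp only [Fin.sum_univ_add, Fin.append_left, Fin.append_right] at hc
    have h₁ : ∑ i, c (Fin.castAdd h' i) • b i ∈ W :=
      Submodule.sum_mem _ fun i _ => Submodule.smul_mem _ _ (hb i)
    have h₂ := hi' (fun i => c (Fin.natAdd h i)) ((Submodule.add_mem_iff_right _ h₁).1 (hUW hc))
    have h₃ := hi (fun i => c (Fin.castAdd h' i)) ((Submodule.add_mem_iff_left _
      (Submodule.sum_mem _ fun i _ => hq _ (h₂ i) _ (hb' i))).1 hc)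
    exact fun i => Fin.addCases h₃ h₂ i
  · obtain ⟨k, hk⟩ := hs' x hx
    obtain ⟨w, hw, y, hy, hwy⟩ := Submodule.mem_sup.1 hk
    obtain ⟨l, hl⟩ := hs w hw
    refine ⟨l + k, ?_⟩
    rw [pow_add, mul_smul, ← hwy, smul_add]
    have hl' : Set.range b ⊆ Set.range (Fin.append b b') := by
      rintro _ ⟨i, rfl⟩; exact ⟨Fin.castAdd h' i, Fin.append_left _ _ _⟩
    have hr' : Set.range b' ⊆ Set.range (Fin.append b b') := by
      rintro _ ⟨i, rfl⟩; exact ⟨Fin.natAdd h i, Fin.append_right _ _ _⟩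
    exact add_mem (sup_le_sup_left (Submodule.span_mono (R := R) hl') U hl)
      (Submodule.smul_mem _ _ (Submodule.mem_sup_right (Submodule.span_mono hr' hy)))

/-- The two hypotheses say that `φ` induces an injection of `V / U` into `M' / U'`, which carries
the family along. -/
theorem map (H : GenericallyFree q f h U V) (φ : M →ₗ[R] M') {U' : Submodule R M'}
    (hU : ∀ x ∈ U, φ x ∈ U') (hV : ∀ x ∈ V, φ x ∈ U' → x ∈ U) :
    GenericallyFree q f h U' (U' ⊔ V.map φ) := by
  obtain ⟨b, hb, hi, hs⟩ := H
  refine ⟨φ ∘ b, fun i => Submodule.mem_sup_right ⟨b i, hb i, rfl⟩, fun c hc => hi c ?_,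
    fun x hx => ?_⟩
  · refine hV _ (Submodule.sum_mem _ fun i _ => Submodule.smul_mem _ _ (hb i)) ?_
    simpa using hc
  · obtain ⟨u, hu, _, ⟨v, hv, rfl⟩, rfl⟩ := Submodule.mem_sup.1 hx
    obtain ⟨k, hk⟩ := hs v hv
    obtain ⟨w, hw, y, hy, hwy⟩ := Submodule.mem_sup.1 hk
    refine ⟨k, ?_⟩
    rw [smul_add, ← map_smul, ← hwy, map_add]
    refine add_mem (Submodule.mem_sup_left (Submodule.smul_mem _ _ hu))
      (add_mem (Submodule.mem_sup_left (hU w hw)) (Submodule.mem_sup_right ?_))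
    rw [Set.range_comp, ← Submodule.map_span]
    exact Submodule.mem_map_of_mem hy

theorem comap {φ : M →ₗ[R] M'} (hφ : Function.Surjective φ)
    (H : GenericallyFree q f h (⊥ : Submodule R M') ⊤) :
    GenericallyFree q f h (LinearMap.ker φ) ⊤ := by
  obtain ⟨b, hb, hi, hs⟩ := H
  choose b' hb' using fun i => hφ (b i)
  refine ⟨b', fun i => trivial, fun c hc => hi c ?_, fun x _ => ?_⟩
  · simpa [hb'] using hc
  · obtain ⟨k, hk⟩ := hs (φ x) trivial
    refine ⟨k, ?_⟩
    have h₁ : Submodule.span R (Set.range b) = (Submodule.span R (Set.range b')).map φ := by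
      rw [Submodule.map_span, ← Set.range_comp]
      congr 2
      exact (funext hb').symm
    rw [bot_sup_eq, h₁, ← map_smul] at hk
    rw [sup_comm, ← Submodule.comap_map_eq]
    exact hk

end GenericallyFree

-- Dévissage to modules `R ⧸ p`, where `q ≤ p` because `q` kills the module. If `p = q` the module
-- is free of rank one; otherwise an element of `p` outside `q` kills it.
variable (R) in
theorem exists_genericallyFree_bot_top [IsNoetherianRing R] (q : Ideal R) [hq : q.IsPrime]
    (hM : Module.Finite R M) (hqM : ∀ r ∈ q, ∀ x : M, r • x = 0) :
    ∃ f ∉ q, ∃ h, GenericallyFree q f h (⊥ : Submodule R M) ⊤ := by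
  induction hM using IsNoetherianRing.induction_on_isQuotientEquivQuotientPrime R with
  | subsingleton N =>
    exact ⟨1, q.one_notMem, 0, .of_le fun x _ => by simp [Subsingleton.elim x 0]⟩
  | quotient N p e =>
    have hqp : q ≤ p.1 := fun r hr => by
      rw [← Ideal.Quotient.eq_zero_iff_mem]
      have := hqM r hr (e.symm 1)
      rw [← map_smul, e.symm.map_eq_zero_iff, Algebra.smul_def, mul_one] at this
      exact this
    by_cases hpq : p.1 ≤ q
    · refine ⟨1, q.one_notMem, 1, fun _ => e.symm 1, fun _ => trivial, fun c hc i => ?_,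
        fun x _ => ⟨0, ?_⟩⟩
      · rw [Fin.sum_univ_one, Submodule.mem_bot, ← map_smul, e.symm.map_eq_zero_iff,
          Algebra.smul_def, mul_one] at hc
        rw [Subsingleton.elim i 0]
        exact hpq (Ideal.Quotient.eq_zero_iff_mem.1 hc)
      · obtain ⟨r, hr⟩ := Ideal.Quotient.mk_surjective (e x)
        refine Submodule.mem_sup_right ?_
        have : x = r • e.symm 1 := by
          rw [← map_smul, Algebra.smul_def, mul_one, LinearEquiv.eq_symm_apply, ← hr]
          rfl
        rw [pow_zero, one_smul, this]
        exact Submodule.smul_mem _ _ (Submodule.subset_span ⟨0, rfl⟩)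
    · obtain ⟨f, hf, hfq⟩ := SetLike.not_le_iff_exists.1 hpq
      refine ⟨f, hfq, 0, Fin.elim0, fun i => i.elim0, fun _ _ i => i.elim0, fun x _ => ⟨1, ?_⟩⟩
      have : f • x = 0 := by
        rw [← e.map_eq_zero_iff, map_smul, Algebra.smul_def,
          show algebraMap R (R ⧸ p.1) f = 0 from Ideal.Quotient.eq_zero_iff_mem.2 hf, zero_mul]
      rw [pow_one, this]
      exact zero_mem _
  | exact N₁ N₂ N₃ φ ψ hφ hψ hex ih₁ ih₃ =>
    obtain ⟨f, hf, h, H⟩ := ih₁ fun r hr x => hφ (by rw [map_smul, hqM r hr, map_zero])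
    obtain ⟨f', hf', h', H'⟩ := ih₃ fun r hr x => by
      obtain ⟨y, rfl⟩ := hψ x
      rw [← map_smul, hqM r hr, map_zero]
    refine ⟨f * f', fun hff => (hq.mem_or_mem hff).elim hf hf', h + h', ?_⟩
    have H₁ := (H.map φ (U' := ⊥) (by simp) fun x _ hx => hφ (by simpa using hx)).of_dvd
      (dvd_mul_right f f')
    have H₂ := (H'.comap hψ).of_dvd (dvd_mul_left f' f)
    rw [bot_sup_eq, Submodule.map_top, ← hex.linearMap_ker_eq] at H₁
    exact H₁.trans H₂ bot_le le_top fun r hr x _ => by simp [hqM r hr x]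

theorem exists_genericallyFree [IsNoetherianRing R] (q : Ideal R) [q.IsPrime]
    {U V : Submodule R M} (hUV : U ≤ V) [Module.Finite R (V ⧸ U.submoduleOf V)]
    (hqM : ∀ r ∈ q, ∀ x ∈ V, r • x ∈ U) :
    ∃ f ∉ q, ∃ h, GenericallyFree q f h U V := by
  obtain ⟨f, hf, h, H⟩ := exists_genericallyFree_bot_top R
    (M := V ⧸ U.submoduleOf V) q inferInstance fun r hr x => by
      obtain ⟨x, rfl⟩ := Submodule.Quotient.mk_surjective _ x
      rw [← Submodule.Quotient.mk_smul, Submodule.Quotient.mk_eq_zero]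
      exact hqM r hr x x.2
  refine ⟨f, hf, h, ?_⟩
  have H' := (H.comap (Submodule.mkQ_surjective _)).map V.subtype (U' := U)
    (fun x hx => by rw [Submodule.ker_mkQ] at hx; exact hx)
    (fun x _ hx => by rw [Submodule.ker_mkQ]; exact hx)
  rwa [Submodule.map_top, Submodule.range_subtype, sup_eq_right.2 hUV] at H'

end GenericallyFree

/-! ### Uniform generic freeness along filtrations -/

section Filtration

variable {A M : Type*} [CommRing A] [AddCommGroup M] [Module A M] {I : Ideal A}

theorem filtration_le_of_submodule_le {F G : I.Filtration M} (h : F.submodule ≤ G.submodule) :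
    F ≤ G := fun n x hx => by
  have h₁ : PolynomialModule.single A n x ∈ F.submodule := fun i => by
    rw [PolynomialModule.coeff_single, Finsupp.single_apply]
    split_ifs with hi
    · exact hi ▸ hx
    · exact zero_mem _
  simpa [PolynomialModule.coeff_single] using h h₁ n

theorem filtration_submodule_mono {F G : I.Filtration M} (h : F ≤ G) :
    F.submodule ≤ G.submodule :=
  fun _ hx i => h i (hx i)

/-- The Rees module of the `I`-adic filtration is finite over the Noetherian Rees algebra, so the
ascending chain of Rees submodules stabilizes in all degrees at once. -/
theorem exists_succ_le_of_monotone_filtration [IsNoetherianRing A] [Module.Finite A M]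
    (T : ℕ → I.Filtration M) (hT : Monotone T) (hle : ∀ k, T k ≤ I.stableFiltration ⊤) :
    ∃ c, T (c + 1) ≤ T c := by
  have hfg : (I.stableFiltration (⊤ : Submodule A M)).submodule.FG :=
    (Ideal.Filtration.submodule_fg_iff_stable _ fun i => IsNoetherian.noetherian _).2
      (I.stableFiltration_stable ⊤)
  have := isNoetherian_of_fg_of_noetherian _ hfg
  obtain ⟨c, hc⟩ := monotone_stabilizes_iff_noetherian.2 this
    ⟨fun k => (T k).submodule.submoduleOf _, fun k l hkl =>
      Submodule.comap_mono (filtration_submodule_mono (hT hkl))⟩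
  refine ⟨c, filtration_le_of_submodule_le fun x hx => ?_⟩
  have hx' : (⟨x, filtration_submodule_mono (hle _) hx⟩ : (I.stableFiltration ⊤).submodule) ∈
      (T (c + 1)).submodule.submoduleOf (I.stableFiltration (⊤ : Submodule A M)).submodule := hx
  have h₁ : (T c).submodule.submoduleOf (I.stableFiltration (⊤ : Submodule A M)).submodule =
    (T (c + 1)).submodule.submoduleOf _ := hc (c + 1) c.le_succ
  rw [← h₁] at hx'
  exact hx'

/-- The elements of `V` that multiplication by `a` maps to `T`. -/
def colonFiltration (a : A) (T V : I.Filtration M) : I.Filtration M where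
  N n := V.N n ⊓ (T.N (n + 1)).comap (LinearMap.lsmul A M a)
  mono n := inf_le_inf (V.mono n) (Submodule.comap_mono (T.mono (n + 1)))
  smul_le n := Submodule.smul_le.2 fun r hr x hx =>
    ⟨V.smul_le n (Submodule.smul_mem_smul hr hx.1), by
      have := T.smul_le (n + 1) (Submodule.smul_mem_smul hr hx.2)
      rwa [LinearMap.lsmul_apply, smul_comm] at this⟩

theorem colonFiltration_le (a : A) (T V : I.Filtration M) : colonFiltration a T V ≤ V :=
  fun _ => inf_le_left

theorem le_colonFiltration {a : A} (ha : a ∈ I) {T V : I.Filtration M} (h : T ≤ V) :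
    T ≤ colonFiltration a T V :=
  fun n _ hx => ⟨h n hx, T.smul_le n (Submodule.smul_mem_smul ha hx)⟩

/-- The filtration `T + a V`, where multiplication by `a` raises degrees by one. -/
def addSMulFiltration (a : A) (T V : I.Filtration M) (ha : a ∈ I) (h : V.N 1 ≤ T.N 0) :
    I.Filtration M where
  N n := n.casesOn (T.N 0) fun n => T.N (n + 1) ⊔ (V.N n).map (LinearMap.lsmul A M a)
  mono n := by
    cases n with
    | zero =>
      refine sup_le (T.mono 0) (le_trans ?_ h)
      rintro _ ⟨x, hx, rfl⟩
      exact V.smul_le 0 (Submodule.smul_mem_smul ha hx)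
    | succ n => exact sup_le_sup (T.mono (n + 1)) (Submodule.map_mono (V.mono n))
  smul_le n := by
    cases n with
    | zero => exact le_sup_of_le_left (T.smul_le 0)
    | succ n =>
      dsimp only
      rw [Submodule.smul_sup]
      refine sup_le_sup (T.smul_le (n + 1)) ?_
      rw [← Submodule.map_smul'']
      exact Submodule.map_mono (V.smul_le n)

variable {R : Type*} [CommRing R] [Algebra R A] [Module R M] [IsScalarTower R A M]

/-- All the quotients `V n / U n` are free over `R ⧸ q` after inverting one element outside `q`,
and their ranks are eventually given by a polynomial. -/
def UniformlyGenericallyFree (q : Ideal R) (U V : I.Filtration M) : Prop :=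
  ∃ f ∉ q, ∃ h : ℕ → ℕ, EventuallyPolynomial h ∧ ∀ n,
    GenericallyFree q f (h n) ((U.N n).restrictScalars R) ((V.N n).restrictScalars R)

variable {q : Ideal R}

theorem UniformlyGenericallyFree.trans [hq : q.IsPrime] {U W V : I.Filtration M}
    (H : UniformlyGenericallyFree q U W) (H' : UniformlyGenericallyFree q W V) (hUW : U ≤ W)
    (hWV : W ≤ V) (hqM : ∀ r ∈ q, ∀ x : M, r • x = 0) : UniformlyGenericallyFree q U V := by
  obtain ⟨f, hf, h, hh, H⟩ := H
  obtain ⟨f', hf', h', hh', H'⟩ := H'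
  exact ⟨f * f', fun hff => (hq.mem_or_mem hff).elim hf hf', _, hh.add hh', fun n =>
    ((H n).of_dvd (dvd_mul_right f f')).trans ((H' n).of_dvd (dvd_mul_left f' f)) (hUW n) (hWV n)
      fun r hr x _ => by rw [hqM r hr x]; exact zero_mem _⟩

theorem finite_of_smul_top_eq_bot [Module.Finite A M] (I : Ideal A) [Module.Finite R (A ⧸ I)]
    (h : I • (⊤ : Submodule A M) = ⊥) : Module.Finite R M := by
  have ht : Module.IsTorsionBySet A M I := fun x a => by
    have := Submodule.smul_mem_smul a.2 (Submodule.mem_top (x := x))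
    rwa [h, Submodule.mem_bot] at this
  let _ := ht.module
  have : IsScalarTower A (A ⧸ I) M := ht.isScalarTower
  have : IsScalarTower R (A ⧸ I) M := ht.isScalarTower
  have : Module.Finite (A ⧸ I) M := Module.Finite.of_restrictScalars_finite A _ _
  exact Module.Finite.trans (A ⧸ I) M

theorem finite_of_pow_smul_top_eq_bot [IsNoetherianRing A] (I : Ideal A) [Module.Finite R (A ⧸ I)]
    (n : ℕ) [Module.Finite A M] (h : I ^ n • (⊤ : Submodule A M) = ⊥) : Module.Finite R M := by
  induction n generalizing M with
  | zero =>
    have : Subsingleton M := (Submodule.subsingleton_iff A).1 (subsingleton_of_bot_eq_top (by simpa using h.symm))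
    infer_instance
  | succ n ih =>
    let N : Submodule A M := I • ⊤
    have h₁ : Module.Finite R N := ih <| by
      apply Submodule.map_injective_of_injective N.injective_subtype
      rw [Submodule.map_smul'', Submodule.map_top, Submodule.range_subtype, Submodule.map_bot,
        ← mul_smul, ← pow_succ, h]
    have h₂ : Module.Finite R (M ⧸ N) := finite_of_smul_top_eq_bot I <| by
      rw [← Submodule.range_mkQ N, ← Submodule.map_top, ← Submodule.map_smul'']
      exact Submodule.mkQ_map_self N
    have h₃ : Module.Finite R (N.restrictScalars R) := h₁
    have h₄ : Module.Finite R (M ⧸ N.restrictScalars R) := h₂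
    exact Module.Finite.of_submodule_quotient (N.restrictScalars R)

variable (R) in
theorem finite_quotient_pow_smul_top [IsNoetherianRing A] (I : Ideal A) [Module.Finite R (A ⧸ I)]
    (M : Type*) [AddCommGroup M] [Module R M] [Module A M] [IsScalarTower R A M]
    [Module.Finite A M] (n : ℕ) : Module.Finite R (M ⧸ (I ^ n • ⊤ : Submodule A M)) :=
  finite_of_pow_smul_top_eq_bot I n <| by
    rw [← Submodule.range_mkQ, ← Submodule.map_top, ← Submodule.map_smul'',
      Submodule.mkQ_map_self]

theorem finite_subquotient [IsNoetherianRing A] [Module.Finite A M] [Module.Finite R (A ⧸ I)]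
    {U V : Submodule A M} (h : I • V ≤ U) :
    Module.Finite R (V.restrictScalars R ⧸
      (U.restrictScalars R).submoduleOf (V.restrictScalars R)) := by
  have : Module.Finite R (V ⧸ U.submoduleOf V) := finite_of_smul_top_eq_bot I <| by
    rw [← Submodule.range_mkQ, ← Submodule.map_top, ← Submodule.map_smul'',
      eq_bot_iff, Submodule.map_le_iff_le_comap, Submodule.comap_bot, Submodule.ker_mkQ]
    refine Submodule.smul_le.2 fun r hr x _ => h (Submodule.smul_mem_smul hr x.2)
  exact this

/-- The base case: `I` kills the graded module `V / U`. By Artin–Rees `V` is stable, so only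
finitely many degrees are nonzero and the product of their denominators works. -/
theorem uniformlyGenericallyFree_of_smul_le [hq : q.IsPrime] [IsNoetherianRing R] [IsNoetherianRing A]
    [Module.Finite A M] [Module.Finite R (A ⧸ I)] (hqM : ∀ r ∈ q, ∀ x : M, r • x = 0)
    {U V : I.Filtration M} (hUV : U ≤ V) (hV : V ≤ I.stableFiltration ⊤)
    (h : ∀ n, V.N (n + 1) ≤ U.N n) (hI : ∀ n, I • V.N n ≤ U.N (n + 1)) :
    UniformlyGenericallyFree q U V := by
  obtain ⟨N, hN⟩ := (I.stableFiltration_stable (⊤ : Submodule A M)).of_le hV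
  -- Stability from `N` on gives `V (n + 1) = I • V n ≤ U (n + 1)`, so the quotients vanish only
  -- from `N + 1` on.
  have hle : ∀ n ≥ N + 1, V.N n ≤ U.N n := fun n hn => by
    obtain ⟨n, rfl⟩ : ∃ m, n = m + 1 := ⟨n - 1, by omega⟩
    rw [← hN n (by omega)]
    exact hI n
  have key : ∀ n, ∃ f ∉ q, ∃ h, GenericallyFree q f h ((U.N n).restrictScalars R)
      ((V.N n).restrictScalars R) := fun n => by
    have := finite_subquotient (R := R) ((V.smul_le n).trans (h n))
    exact exists_genericallyFree q (hUV n) fun r hr x _ => by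
      rw [hqM r hr x]; exact zero_mem _
  choose f hf h' H using key
  refine ⟨∏ i ∈ Finset.range (N + 1), f i, fun hmem => ?_,
    fun n => if n < N + 1 then h' n else 0, .of_eventually_eq_zero (N + 1) fun n hn => ?_,
    fun n => ?_⟩
  · obtain ⟨i, -, hi⟩ := (hq.prod_mem_iff).1 hmem
    exact hf i hi
  · exact if_neg (by omega)
  · dsimp only
    split_ifs with hn
    · exact (H n).of_dvd (Finset.dvd_prod_of_mem f (Finset.mem_range.2 hn))
    · exact .of_le (hle n (by omega))

/-- When `a` acts injectively on `V / T`, raising degrees by one, the rank in degree `n + 1` is the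
rank in degree `n` plus that of the cokernel in degree `n + 1`. Ranks are thus partial sums of
cokernel ranks, and `f` stays the same in every degree. -/
theorem UniformlyGenericallyFree.of_addSMulFiltration {a : A} (ha : a ∈ I) {T V : I.Filtration M}
    (hqM : ∀ r ∈ q, ∀ x : M, r • x = 0) (hTV : T ≤ V) (h : V.N 1 ≤ T.N 0)
    (hreg : colonFiltration a T V ≤ T)
    (H : UniformlyGenericallyFree q (addSMulFiltration a T V ha h) V) :
    UniformlyGenericallyFree q T V := by
  obtain ⟨f, hf, g, hg, H⟩ := H
  refine ⟨f, hf, _, hg.sum_range.comp_succ, fun n => ?_⟩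
  induction n with
  | zero => rw [zero_add, Finset.sum_range_one]; exact H 0
  | succ n ih =>
    rw [Finset.sum_range_succ]
    have h₁ := ih.map ((LinearMap.lsmul A M a).restrictScalars R)
      (U' := (T.N (n + 1)).restrictScalars R)
      (fun x hx => T.smul_le n (Submodule.smul_mem_smul ha hx)) fun x hx hx' => hreg n ⟨hx, hx'⟩
    have h₂ : (T.N (n + 1)).restrictScalars R ⊔ ((V.N n).restrictScalars R).map
        ((LinearMap.lsmul A M a).restrictScalars R) =
        ((addSMulFiltration a T V ha h).N (n + 1)).restrictScalars R := by
      change _ = (T.N (n + 1) ⊔ (V.N n).map (LinearMap.lsmul A M a)).restrictScalars R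
      ext x
      simp only [Submodule.mem_sup, Submodule.restrictScalars_mem, Submodule.mem_map]
      rfl
    rw [h₂] at h₁
    refine h₁.trans (H (n + 1)) (fun x hx => Submodule.mem_sup_left hx) ?_ fun r hr x _ => by
      rw [hqM r hr x]; exact zero_mem _
    refine sup_le (hTV (n + 1)) ?_
    rintro _ ⟨x, hx, rfl⟩
    exact V.smul_le n (Submodule.smul_mem_smul ha hx)

/-- `J` collects the elements already known to kill the graded module `V / U`, and `t` the
generators still to be treated. A generator `a` moves from `t` to `J` on the subquotients that it
kills. -/
theorem uniformlyGenericallyFree_of_le_sup_span [hq : q.IsPrime] [IsNoetherianRing R] [IsNoetherianRing A]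
    [Module.Finite A M] [Module.Finite R (A ⧸ I)] (hqM : ∀ r ∈ q, ∀ x : M, r • x = 0)
    (t : Finset A) (ht : ∀ a ∈ t, a ∈ I) (J : Ideal A) (hIJ : I ≤ J ⊔ Ideal.span t)
    {U V : I.Filtration M} (hUV : U ≤ V) (hV : V ≤ I.stableFiltration ⊤)
    (h : ∀ n, V.N (n + 1) ≤ U.N n) (hJ : ∀ n, J • V.N n ≤ U.N (n + 1)) :
    UniformlyGenericallyFree q U V := by
  classical
  induction t using Finset.induction_on generalizing J U V with
  | empty =>
    refine uniformlyGenericallyFree_of_smul_le hqM hUV hV h fun n => ?_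
    exact (Submodule.smul_mono_left (by simpa using hIJ)).trans (hJ n)
  | insert a t _ ih =>
    have ha : a ∈ I := ht a (Finset.mem_insert_self a t)
    have ih' := @ih (fun b hb => ht b (Finset.mem_insert_of_mem hb)) (J ⊔ Ideal.span {a})
      (by rwa [sup_assoc, ← Ideal.span_union, ← Set.insert_eq, ← Finset.coe_insert])
    -- `T k / U` is the kernel of `a ^ k` on `V / U`, so `a` kills each `T (k + 1) / T k`.
    let T : ℕ → I.Filtration M := fun k => (fun T => colonFiltration a T V)^[k] U
    have hTs : ∀ k, T (k + 1) = colonFiltration a (T k) V := fun k =>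
      Function.iterate_succ_apply' _ _ _
    have hTV : ∀ k, T k ≤ V := fun k => by
      cases k with
      | zero => exact hUV
      | succ k => rw [hTs]; exact colonFiltration_le _ _ _
    have hT : Monotone T := monotone_nat_of_le_succ fun k => by
      rw [hTs]; exact le_colonFiltration ha (hTV k)
    have hUT : ∀ k, U ≤ T k := fun k => hT (Nat.zero_le k)
    have hstep : ∀ k, UniformlyGenericallyFree q U (T k) := fun k => by
      induction k with
      | zero => exact ⟨1, q.one_notMem, fun _ => 0, .of_eventually_eq_zero 0 fun _ _ => rfl,
          fun _ => .of_le le_rfl⟩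
      | succ k ihk =>
        refine ihk.trans (ih' (hT k.le_succ) ((hTV _).trans hV)
          (fun n => ((hTV _ _).trans (h n)).trans (hUT k n)) fun n => ?_) (hUT k)
          (hT k.le_succ) hqM
        rw [Submodule.sup_smul]
        refine sup_le ((smul_mono_right _ (hTV _ n)).trans ((hJ n).trans (hUT k _))) ?_
        rw [hTs, Submodule.ideal_span_singleton_smul]
        rintro _ ⟨x, hx, rfl⟩
        exact hx.2
    obtain ⟨c, hc⟩ := exists_succ_le_of_monotone_filtration T hT fun k => (hTV k).trans hV
    rw [hTs] at hc
    have h0 : V.N 1 ≤ (T c).N 0 := (h 0).trans (hUT c 0)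
    have hle : T c ≤ addSMulFiltration a (T c) V ha h0 := fun n => by
      cases n with
      | zero => exact le_rfl
      | succ n => exact le_sup_left
    -- Past the stable index `c`, `a` is injective on `V / T c`, and its cokernel is killed by `a`.
    refine (hstep c).trans (.of_addSMulFiltration ha hqM (hTV c) h0 hc (ih' (fun n => ?_) hV
      (fun n => (h n).trans ((hUT c n).trans (hle n))) fun n => ?_)) (hUT c) (hTV c) hqM
    · cases n with
      | zero => exact hTV c 0
      | succ n =>
        refine sup_le (hTV c (n + 1)) ?_
        rintro _ ⟨x, hx, rfl⟩
        exact V.smul_le n (Submodule.smul_mem_smul ha hx)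
    · rw [Submodule.sup_smul]
      refine sup_le ((hJ n).trans ((hUT c _).trans (hle _))) ?_
      rw [Submodule.ideal_span_singleton_smul]
      rintro _ ⟨x, hx, rfl⟩
      exact Submodule.mem_sup_right ⟨x, hx, rfl⟩

/-- Taking `U` to be the shift of the `I`-adic filtration makes `V / U` the associated graded
module; summing its ranks gives those of `M/IⁿM`. -/
theorem exists_genericallyFree_pow_smul_top [IsNoetherianRing R] [IsNoetherianRing A]
    [Module.Finite A M] (I : Ideal A) [Module.Finite R (A ⧸ I)] (q : Ideal R) [hq : q.IsPrime]
    (hqM : ∀ r ∈ q, ∀ x : M, r • x = 0) :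
    ∃ f ∉ q, ∃ h : ℕ → ℕ, EventuallyPolynomial h ∧ ∀ n,
      GenericallyFree q f (h n) ((I ^ n • ⊤ : Submodule A M).restrictScalars R) ⊤ := by
  obtain ⟨t, ht⟩ := IsNoetherian.noetherian I
  let V := I.stableFiltration (⊤ : Submodule A M)
  let U : I.Filtration M :=
    ⟨fun n => V.N (n + 1), fun n => V.mono (n + 1), fun n => V.smul_le (n + 1)⟩
  obtain ⟨f, hf, h, hh, H⟩ := uniformlyGenericallyFree_of_le_sup_span hqM t
    (fun a ha => ht ▸ Ideal.subset_span ha) ⊥ (by rw [bot_sup_eq]; exact ht.ge) (U := U) (V := V)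
    (fun n => V.mono n) le_rfl (fun n => le_rfl) fun n => by simp
  refine ⟨f, hf, _, hh.sum_range, fun n => ?_⟩
  induction n with
  | zero => exact .of_le (by simp)
  | succ n ih =>
    rw [Finset.sum_range_succ, add_comm]
    exact (H n).trans ih (V.mono n) le_top fun r hr x _ => by
      rw [hqM r hr x]; exact zero_mem _

end Filtration

/-! ### Fibre dimensions of finite modules -/

section FiberDimension

variable {R Q : Type*} [CommRing R] [AddCommGroup Q] [Module R Q]

theorem span_one_tmul_eq_top (p : PrimeSpectrum R) {f : R} (hf : f ∉ p.asIdeal) {s : Set Q}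
    (hs : ∀ x : Q, ∃ k : ℕ, f ^ k • x ∈ Submodule.span R s) :
    Submodule.span p.asIdeal.ResidueField
      ((fun x : Q => (1 : p.asIdeal.ResidueField) ⊗ₜ[R] x) '' s) = ⊤ := by
  rw [eq_top_iff]
  rintro x -
  induction x using TensorProduct.induction_on with
  | zero => exact zero_mem _
  | add x y hx hy => exact add_mem hx hy
  | tmul c x =>
    obtain ⟨k, hk⟩ := hs x
    have h₁ : ∀ y ∈ Submodule.span R s, (1 : p.asIdeal.ResidueField) ⊗ₜ[R] y ∈
        Submodule.span p.asIdeal.ResidueField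
          ((fun x : Q => (1 : p.asIdeal.ResidueField) ⊗ₜ[R] x) '' s) := fun y hy => by
      induction hy using Submodule.span_induction with
      | mem y hy => exact Submodule.subset_span ⟨y, hy, rfl⟩
      | zero => rw [TensorProduct.tmul_zero]; exact zero_mem _
      | add y z _ _ hy hz => rw [TensorProduct.tmul_add]; exact add_mem hy hz
      | smul r y _ hy =>
        rw [TensorProduct.tmul_smul, ← algebraMap_smul p.asIdeal.ResidueField r]
        exact Submodule.smul_mem _ _ hy
    have h₂ := h₁ _ hk
    have hu : algebraMap R p.asIdeal.ResidueField (f ^ k) ≠ 0 := by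
      rw [map_pow]
      exact pow_ne_zero _ (by rwa [Ne, Ideal.algebraMap_residueField_eq_zero])
    rw [TensorProduct.tmul_smul, ← algebraMap_smul p.asIdeal.ResidueField] at h₂
    have h₃ := Submodule.smul_mem _ c ((Submodule.smul_mem_iff _ hu).1 h₂)
    rwa [TensorProduct.smul_tmul', smul_eq_mul, mul_one] at h₃

theorem exists_pow_smul_mem_of_forall [Module.Finite R Q] {f : R} {N : Submodule R Q}
    (hN : ∀ x : Q, ∃ k : ℕ, f ^ k • x ∈ N) : ∃ k : ℕ, ∀ x : Q, f ^ k • x ∈ N := by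
  obtain ⟨s, hs⟩ := Module.Finite.fg_top (R := R) (M := Q)
  choose k hk using hN
  refine ⟨∑ x ∈ s, k x, fun x => ?_⟩
  have h₁ : Submodule.span R (s : Set Q) ≤
      N.comap (LinearMap.lsmul R Q (f ^ ∑ x ∈ s, k x)) := by
    refine Submodule.span_le.2 fun y hy => ?_
    change f ^ (∑ x ∈ s, k x) • y ∈ N
    obtain ⟨l, hl⟩ := Nat.exists_eq_add_of_le (Finset.single_le_sum (f := k)
      (fun _ _ => Nat.zero_le _) hy)
    rw [hl, add_comm, pow_add, mul_smul]
    exact Submodule.smul_mem _ _ (hk y)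
  exact h₁ (hs ▸ Submodule.mem_top)

/-- The family becomes a basis of the fibre: `f` is invertible in `k(p)`, and relations have
coefficients in `q ≤ p`, which vanish there. -/
theorem GenericallyFree.finrank_eq [Module.Finite R Q] {q : Ideal R} {f : R} {h : ℕ}
    (H : GenericallyFree q f h (⊥ : Submodule R Q) ⊤) (p : PrimeSpectrum R) (hqp : q ≤ p.asIdeal)
    (hf : f ∉ p.asIdeal) :
    Module.finrank p.asIdeal.ResidueField (p.asIdeal.ResidueField ⊗[R] Q) = h := by
  obtain ⟨b, -, hi, hs⟩ := H
  have hs' : ∀ x : Q, ∃ k : ℕ, f ^ k • x ∈ Submodule.span R (Set.range b) := fun x => by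
    simpa using hs x trivial
  let φ : (Fin h → R) →ₗ[R] Q := Fintype.linearCombination R b
  have hφ : LinearMap.range φ = Submodule.span R (Set.range b) :=
    Fintype.range_linearCombination R b
  obtain ⟨k, hk⟩ := exists_pow_smul_mem_of_forall hs'
  let g : (Fin h → R) →ₗ[R] (Fin h → p.asIdeal.ResidueField) :=
    LinearMap.pi fun i => (Algebra.linearMap R _).comp (LinearMap.proj i)
  have hg : LinearMap.ker φ ≤ LinearMap.ker g := fun c hc => by
    rw [LinearMap.mem_ker] at hc ⊢
    funext i
    refine Ideal.algebraMap_residueField_eq_zero.2 (hqp (hi c ?_ i))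
    simpa [φ, Fintype.linearCombination_apply] using hc
  -- Coordinates with respect to `b`, multiplied by `f ^ k` to make them defined on all of `Q`; they
  -- are well defined in `k(p)` as relations vanish there.
  let l : Q →ₗ[R] (Fin h → p.asIdeal.ResidueField) :=
    ((LinearMap.ker φ).liftQ g hg).comp ((φ.quotKerEquivRange.symm.toLinearMap).comp
      ((LinearMap.lsmul R Q (f ^ k)).codRestrict (LinearMap.range φ) fun x => by
        rw [hφ]; exact hk x))
  have hl : ∀ c, l (φ c) = f ^ k • g c := fun c => by
    have h₁ : (LinearMap.lsmul R Q (f ^ k)).codRestrict (LinearMap.range φ)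
        (fun x => by rw [hφ]; exact hk x) (φ c) =
        φ.quotKerEquivRange (Submodule.Quotient.mk (f ^ k • c)) := by
      ext
      simp
    change (LinearMap.ker φ).liftQ g hg (φ.quotKerEquivRange.symm _) = _
    rw [h₁, LinearEquiv.symm_apply_apply, Submodule.liftQ_apply, map_smul]
  let v : Fin h → p.asIdeal.ResidueField ⊗[R] Q := fun i => 1 ⊗ₜ[R] b i
  have hv : LinearIndependent p.asIdeal.ResidueField v := by
    rw [Fintype.linearIndependent_iff]
    intro c hc i
    have h₁ := congrArg (LinearMap.liftBaseChange p.asIdeal.ResidueField l) hc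
    have h₂ : ∀ j, l (b j) = f ^ k • Pi.single j (1 : p.asIdeal.ResidueField) := fun j => by
      have : φ (Pi.single j 1) = b j := by simp [φ]
      rw [← this, hl]
      congr 1
      funext i
      by_cases hij : i = j
      · subst hij; simp [g]
      · simp [g, hij]
    rw [map_zero, map_sum] at h₁
    have h₃ := congrFun h₁ i
    simp only [map_smul, v, LinearMap.liftBaseChange_tmul, one_smul, h₂, Finset.sum_apply,
      Pi.smul_apply, Pi.single_apply, Pi.zero_apply] at h₃
    simp only [smul_ite, smul_zero, Finset.sum_ite_eq, Finset.mem_univ, if_true] at h₃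
    rw [smul_eq_mul, Algebra.smul_def, mul_one, mul_eq_zero, map_pow] at h₃
    refine h₃.resolve_right (pow_ne_zero _ ?_)
    rwa [Ne, Ideal.algebraMap_residueField_eq_zero]
  have hv' : ⊤ ≤ Submodule.span p.asIdeal.ResidueField (Set.range v) := by
    rw [← span_one_tmul_eq_top p hf hs', ← Set.range_comp]
    rfl
  rw [Module.finrank_eq_card_basis (Module.Basis.mk hv hv'), Fintype.card_fin]

/-- Nakayama: lift a basis of the fibre at `p` to `Q`. The quotient by the lifts has zero fibre at
`p`, so some `f ∉ p` kills it, and the lifts span every fibre over `D(f)`. -/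
theorem exists_finrank_le [Module.Finite R Q] (p : PrimeSpectrum R) :
    ∃ f ∉ p.asIdeal, ∀ p' : PrimeSpectrum R, f ∉ p'.asIdeal →
      Module.finrank p'.asIdeal.ResidueField (p'.asIdeal.ResidueField ⊗[R] Q) ≤
        Module.finrank p.asIdeal.ResidueField (p.asIdeal.ResidueField ⊗[R] Q) := by
  classical
  let ι : Q → p.asIdeal.ResidueField ⊗[R] Q := fun x => 1 ⊗ₜ[R] x
  have htop := span_one_tmul_eq_top (Q := Q) p (f := 1) p.asIdeal.one_notMem (s := Set.univ)
    fun x => ⟨0, Submodule.subset_span trivial⟩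
  rw [Set.image_univ] at htop
  obtain ⟨κ, a, -, ht, hli⟩ := exists_linearIndependent' p.asIdeal.ResidueField ι
  rw [htop] at ht
  have hfin : Finite κ := hli.finite
  have := Fintype.ofFinite κ
  let N := Submodule.span R (Set.range a)
  have hsub : Subsingleton (p.asIdeal.ResidueField ⊗[R] (Q ⧸ N)) := by
    have h₁ : N.mkQ.baseChange p.asIdeal.ResidueField = 0 := by
      refine LinearMap.ext_on_range ht fun i => ?_
      change (1 : p.asIdeal.ResidueField) ⊗ₜ[R] N.mkQ (a i) = 0
      rw [Submodule.mkQ_apply, (Submodule.Quotient.mk_eq_zero N).2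
        (Submodule.subset_span ⟨i, rfl⟩), TensorProduct.tmul_zero]
    refine subsingleton_of_forall_eq 0 fun x => ?_
    obtain ⟨y, rfl⟩ := LinearMap.lTensor_surjective p.asIdeal.ResidueField N.mkQ_surjective x
    exact LinearMap.congr_fun h₁ y
  have hp : p ∉ Module.support R (Q ⧸ N) := by
    rw [Module.mem_support_iff_nontrivial_residueField_tensorProduct]
    exact not_nontrivial_iff_subsingleton.2 hsub
  rw [Module.mem_support_iff_of_finite] at hp
  obtain ⟨f, hf, hfp⟩ := SetLike.not_le_iff_exists.1 hp
  refine ⟨f, hfp, fun p' hfp' => ?_⟩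
  have h₁ := span_one_tmul_eq_top (Q := Q) p' hfp' (s := Set.range a) fun x => ⟨1, by
    rw [pow_one]
    refine (Submodule.Quotient.mk_eq_zero N).1 ?_
    rw [Submodule.Quotient.mk_smul]
    exact Module.mem_annihilator.1 hf _⟩
  rw [Module.finrank_eq_card_basis (Module.Basis.mk hli ht.ge), ← finrank_top, ← h₁,
    ← Set.range_comp]
  exact finrank_range_le_card _

theorem upperSemicontinuous_finrank [Module.Finite R Q] :
    UpperSemicontinuous fun p : PrimeSpectrum R =>
      Module.finrank p.asIdeal.ResidueField (p.asIdeal.ResidueField ⊗[R] Q) := fun p y hy => by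
  obtain ⟨f, hf, h⟩ := exists_finrank_le (Q := Q) p
  filter_upwards [(PrimeSpectrum.basicOpen f).isOpen.mem_nhds hf] with p' hp'
  exact (h p' hp').trans_lt hy

end FiberDimension

/-- If `p ∈ S` lay in the closure `V(J)` of the complement, a minimal prime `q ≤ p` of `J` would lie
in `S`. With `g` in all other minimal primes but not in `q`, the product `f * g` vanishes on the
complement, hence lies in `J ≤ q`, which is absurd. -/
theorem isOpen_of_forall_le_of_forall_exists {R : Type*} [CommRing R] [IsNoetherianRing R]
    {S : Set (PrimeSpectrum R)} (hS : ∀ q p : PrimeSpectrum R, q ≤ p → p ∈ S → q ∈ S)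
    (hS' : ∀ q ∈ S, ∃ f ∉ q.asIdeal, ∀ p, q ≤ p → f ∉ p.asIdeal → p ∈ S) : IsOpen S := by
  rw [← isClosed_compl_iff, ← closure_subset_iff_isClosed,
    ← PrimeSpectrum.zeroLocus_vanishingIdeal_eq_closure]
  intro p hp hpS
  set J := PrimeSpectrum.vanishingIdeal Sᶜ with hJ
  obtain ⟨q, hq, hqp⟩ := Ideal.exists_minimalPrimes_le (I := J) (J := p.asIdeal) hp
  let q' : PrimeSpectrum R := ⟨q, hq.1.1⟩
  obtain ⟨f, hf, hfS⟩ := hS' q' (hS q' p hqp hpS)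
  have hfin := Ideal.finite_minimalPrimes_of_isNoetherianRing R J
  obtain ⟨g, hg, hgq⟩ : ∃ g, (∀ r ∈ J.minimalPrimes, r ≠ q → g ∈ r) ∧ g ∉ q := by
    by_contra! hcon
    have h₁ : (hfin.toFinset.erase q).inf id ≤ q := fun g hg => hcon g fun r hr hrq =>
      (Finset.inf_le (f := id) (Finset.mem_erase.2 ⟨hrq, hfin.mem_toFinset.2 hr⟩) :
        _ ≤ r) hg
    obtain ⟨r, hr, hrq⟩ := (Ideal.IsPrime.inf_le' hq.1.1).1 h₁
    rw [Finset.mem_erase, Set.Finite.mem_toFinset] at hr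
    exact hr.1 (le_antisymm hrq (hq.2 hr.2.1 hrq))
  have hmem : f * g ∈ J := by
    rw [hJ, PrimeSpectrum.mem_vanishingIdeal]
    intro z hz
    have hJz : J ≤ z.asIdeal := fun x hx => (PrimeSpectrum.mem_vanishingIdeal _ _).1 hx z hz
    obtain ⟨r, hr, hrz⟩ := Ideal.exists_minimalPrimes_le hJz
    by_cases hrq : r = q
    · subst hrq
      refine Ideal.mul_mem_right _ _ ?_
      by_contra hfz
      exact hz (hfS z hrz hfz)
    · exact Ideal.mul_mem_left _ _ (hrz (hg r hr hrq))
  exact (hq.1.1.mem_or_mem (hq.1.2 hmem)).elim hf hgq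

/-! ### Growth of the Hilbert–Samuel function -/

section Growth

variable {K B : Type*} [Field K] [CommRing B] [Algebra K B] {J : Ideal B}

theorem finrank_le_of_exact {V₁ V₂ V₃ : Type*} [AddCommGroup V₁] [AddCommGroup V₂]
    [AddCommGroup V₃] [Module K V₁] [Module K V₂] [Module K V₃] [Module.Finite K V₁]
    [Module.Finite K V₂] [Module.Finite K V₃] {α : V₁ →ₗ[K] V₂} {β : V₂ →ₗ[K] V₃}
    (h : LinearMap.ker β ≤ LinearMap.range α) :
    Module.finrank K V₂ ≤ Module.finrank K V₁ + Module.finrank K V₃ := by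
  have h₁ := β.finrank_range_add_finrank_ker
  have h₂ := Submodule.finrank_mono h
  have h₃ := α.finrank_range_le
  have h₄ := (LinearMap.range β).finrank_le
  omega

variable {N₁ N₂ N₃ : Type*} [AddCommGroup N₁] [AddCommGroup N₂] [AddCommGroup N₃]
  [Module K N₁] [Module K N₂] [Module K N₃] [Module B N₁] [Module B N₂] [Module B N₃]
  [IsScalarTower K B N₁] [IsScalarTower K B N₂] [IsScalarTower K B N₃]

/-- Only right exactness modulo powers of `J` is used, so no injectivity of `f` is needed.
Independent `m` and `n` let multiplication by an element of `J` shift the exponent. -/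
theorem hsFunction_le_of_exact [IsNoetherianRing B] [Module.Finite K (B ⧸ J)] [Module.Finite B N₁]
    [Module.Finite B N₂] [Module.Finite B N₃] {f : N₁ →ₗ[B] N₂} {g : N₂ →ₗ[B] N₃}
    (hg : Function.Surjective g) (hfg : Function.Exact f g) {m n : ℕ}
    (hf : ∀ x ∈ (J ^ m • ⊤ : Submodule B N₁), f x ∈ (J ^ n • ⊤ : Submodule B N₂)) :
    hsFunction K J N₂ n ≤ hsFunction K J N₁ m + hsFunction K J N₃ n := by
  have := finite_quotient_pow_smul_top K J N₁ m
  have := finite_quotient_pow_smul_top K J N₂ n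
  have := finite_quotient_pow_smul_top K J N₃ n
  have hg' : (J ^ n • ⊤ : Submodule B N₂).map g = J ^ n • ⊤ := by
    rw [Submodule.map_smul'', Submodule.map_top, LinearMap.range_eq_top.2 hg]
  refine finrank_le_of_exact (α := (Submodule.mapQ _ _ f hf).restrictScalars K)
    (β := (Submodule.mapQ _ (J ^ n • ⊤) g (Submodule.map_le_iff_le_comap.1 hg'.le)).restrictScalars
      K) fun x hx => ?_
  obtain ⟨x, rfl⟩ := Submodule.Quotient.mk_surjective _ x
  have hx' : g x ∈ (J ^ n • ⊤ : Submodule B N₃) := (Submodule.Quotient.mk_eq_zero _).1 hx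
  rw [← hg'] at hx'
  obtain ⟨y, hy, hyx⟩ := hx'
  obtain ⟨z, hz⟩ := (hfg (x - y)).1 (by rw [map_sub, hyx, sub_self])
  refine ⟨Submodule.Quotient.mk z, ?_⟩
  change Submodule.Quotient.mk (f z) = Submodule.Quotient.mk x
  rw [hz, Submodule.Quotient.eq]
  simpa using hy

theorem hsFunction_zero (N : Type*) [AddCommGroup N] [Module K N] [Module B N]
    [IsScalarTower K B N] : hsFunction K J N 0 = 0 := by
  have : Subsingleton (N ⧸ (J ^ 0 • ⊤ : Submodule B N)) := by
    rw [Submodule.Quotient.subsingleton_iff, pow_zero, one_smul]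
  exact Module.finrank_zero_of_subsingleton

theorem hsFunction_le_sum_quotSMulTop [IsNoetherianRing B] [Module.Finite K (B ⧸ J)]
    (N : Type*) [AddCommGroup N] [Module K N] [Module B N] [IsScalarTower K B N]
    [Module.Finite B N] {x : B} (hx : x ∈ J) (n : ℕ) :
    hsFunction K J N n ≤ ∑ i ∈ Finset.range (n + 1), hsFunction K J (QuotSMulTop x N) i := by
  induction n with
  | zero => rw [hsFunction_zero]; exact Nat.zero_le _
  | succ n ih =>
    rw [Finset.sum_range_succ]
    refine le_trans (hsFunction_le_of_exact (f := LinearMap.lsmul B N x)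
      (g := (x • (⊤ : Submodule B N)).mkQ) (m := n) (Submodule.mkQ_surjective _) ?_ ?_)
      (Nat.add_le_add_right ih _)
    · intro y
      rw [Submodule.mkQ_apply, Submodule.Quotient.mk_eq_zero,
        Submodule.mem_smul_pointwise_iff_exists]
      simp
    · intro y hy
      rw [pow_succ', mul_smul]
      exact Submodule.smul_mem_smul hx hy

theorem hsFunction_le_finrank_of_smul_top_eq_bot [IsNoetherianRing B] [Module.Finite K (B ⧸ J)]
    (N : Type*) [AddCommGroup N] [Module K N] [Module B N] [IsScalarTower K B N]
    [Module.Finite B N] (h : J • (⊤ : Submodule B N) = ⊥) (n : ℕ) :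
    hsFunction K J N n ≤ Module.finrank K N := by
  have : Module.Finite K N := finite_of_smul_top_eq_bot J h
  rw [hsFunction, ← (Submodule.Quotient.restrictScalarsEquiv K (J ^ n • ⊤)).finrank_eq]
  exact Submodule.finrank_quotient_le _

-- The induction step on dimension. Dévissage reduces to `B/P`: if `J ≤ P` the function is bounded,
-- and otherwise an element of `J` outside `P` cuts the dimension by at least one.
universe v in
theorem exists_hsFunction_le_of_forall [IsNoetherianRing B] [Module.Finite K (B ⧸ J)] {d : ℕ}
    (H : ∀ (N : Type v) [AddCommGroup N] [Module K N] [Module B N] [IsScalarTower K B N]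
      [Module.Finite B N], Module.supportDim B N + 1 ≤ d →
      ∃ c, ∀ n, ∑ i ∈ Finset.range (n + 1), hsFunction K J N i ≤ c * (n + 1) ^ d)
    (N : Type v) [AddCommGroup N] [Module K N] [Module B N] [IsScalarTower K B N]
    [hN : Module.Finite B N] (hd : Module.supportDim B N ≤ d) :
    ∃ c, ∀ n, hsFunction K J N n ≤ c * (n + 1) ^ d := by
  rename_i hKN hBN hKBN
  revert hKN hKBN hd
  induction hN using IsNoetherianRing.induction_on_isQuotientEquivQuotientPrime B with
  | subsingleton N =>
    intro _ _ _
    exact ⟨0, fun n => by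
      rw [zero_mul, hsFunction, Module.finrank_zero_of_subsingleton]⟩
  | quotient N P e =>
    intro _ _ hd
    have hann : Module.annihilator B N = P.asIdeal := by
      rw [e.annihilator_eq, Ideal.annihilator_quotient]
    by_cases hJP : J ≤ P.asIdeal
    · refine ⟨Module.finrank K N, fun n => ?_⟩
      refine (hsFunction_le_finrank_of_smul_top_eq_bot N ?_ n).trans
        (Nat.le_mul_of_pos_right _ (by positivity))
      refine eq_bot_iff.2 (Submodule.smul_le.2 fun r hr y _ => ?_)
      exact Module.mem_annihilator.1 (hann ▸ hJP hr) y
    · obtain ⟨x, hxJ, hxP⟩ := SetLike.not_le_iff_exists.1 hJP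
      have hdim := Module.supportDim_quotSMulTop_succ_le_of_notMem_minimalPrimes (M := N) (x := x)
        (by rw [hann, Ideal.minimalPrimes_eq_subsingleton_self]; simpa using hxP)
      obtain ⟨c, hc⟩ := H (QuotSMulTop x N) (hdim.trans hd)
      exact ⟨c, fun n => (hsFunction_le_sum_quotSMulTop N hxJ n).trans (hc n)⟩
  | exact N₁ N₂ N₃ f g hf hg hfg ih₁ ih₃ =>
    intro _ _ hd
    let _ : Module K N₁ := Module.compHom N₁ (algebraMap K B)
    let _ : Module K N₃ := Module.compHom N₃ (algebraMap K B)
    have : IsScalarTower K B N₁ := .of_algebraMap_smul fun _ _ => rfl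
    have : IsScalarTower K B N₃ := .of_algebraMap_smul fun _ _ => rfl
    obtain ⟨c₁, h₁⟩ := ih₁ ((Module.supportDim_le_of_injective f hf).trans hd)
    obtain ⟨c₃, h₃⟩ := ih₃ ((Module.supportDim_le_of_surjective g hg).trans hd)
    refine ⟨c₁ + c₃, fun n => (hsFunction_le_of_exact hg hfg (m := n) fun x hx => ?_).trans
      ((Nat.add_le_add (h₁ n) (h₃ n)).trans_eq (add_mul _ _ _).symm)⟩
    have := Submodule.mem_map_of_mem (f := f) hx
    rw [Submodule.map_smul''] at this
    exact (smul_mono_right (J ^ n) le_top : J ^ n • LinearMap.range f ≤ J ^ n • ⊤)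
      (by rwa [← Submodule.map_top])

universe v in
theorem exists_hsFunction_le [IsNoetherianRing B] [Module.Finite K (B ⧸ J)] (d : ℕ)
    (N : Type v) [AddCommGroup N] [Module K N] [Module B N] [IsScalarTower K B N]
    [Module.Finite B N] (hd : Module.supportDim B N ≤ d) :
    ∃ c, ∀ n, hsFunction K J N n ≤ c * (n + 1) ^ d := by
  induction d generalizing N with
  | zero =>
    refine exists_hsFunction_le_of_forall (fun N _ _ _ _ _ hN => ⟨0, fun n => ?_⟩) N hd
    have : Subsingleton N := by
      rw [← Module.supportDim_eq_bot_iff_subsingleton B]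
      generalize Module.supportDim B N = a at hN
      induction a using WithBot.recBotCoe with
      | bot => rfl
      | coe a =>
        have h : a + 1 ≤ 0 := by exact_mod_cast hN
        simp at h
    rw [zero_mul, Finset.sum_eq_zero fun i _ => ?_]
    rw [hsFunction, Module.finrank_zero_of_subsingleton]
  | succ d ih =>
    refine exists_hsFunction_le_of_forall (fun N _ _ _ _ _ hN => ?_) N hd
    have hN' : Module.supportDim B N ≤ d := by
      generalize Module.supportDim B N = a at hN
      induction a using WithBot.recBotCoe with
      | bot => exact bot_le
      | coe a =>
        have h : a + 1 ≤ d + 1 := by exact_mod_cast hN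
        exact_mod_cast (ENat.add_le_add_iff_right ENat.one_ne_top).1 h
    obtain ⟨c, hc⟩ := ih N hN'
    refine ⟨c, fun n => (Finset.sum_le_card_nsmul _ _ (c * (n + 1) ^ d) fun i hi => ?_).trans ?_⟩
    · refine (hc i).trans (Nat.mul_le_mul_left _ (Nat.pow_le_pow_left ?_ d))
      exact Finset.mem_range.1 hi
    · rw [Finset.card_range, smul_eq_mul]
      exact le_of_eq (by ring)

end Growth

/-! ### Fibre rings, fibre modules and their quotients -/

section Fiber

variable {R A M : Type*} [CommRing R] [CommRing A] [Algebra R A] [AddCommGroup M] [Module R M]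
  [Module A M] [IsScalarTower R A M] (p : PrimeSpectrum R)

variable {p} in
/-- The pure tensor `c ⊗ m` as an element of the fibre `M(p)`. -/
noncomputable def fiberTmul (c : p.asIdeal.ResidueField) (m : M) : fiberModule p M :=
  c ⊗ₜ[R] m

variable {p} in
@[elab_as_elim]
theorem fiberModule_induction {motive : fiberModule p M → Prop} (x : fiberModule p M)
    (zero : motive 0) (tmul : ∀ c m, motive (fiberTmul c m))
    (add : ∀ x y, motive x → motive y → motive (x + y)) : motive x :=
  TensorProduct.induction_on (motive := motive) x zero tmul add

theorem fiberTmul_add (c : p.asIdeal.ResidueField) (m m' : M) :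
    fiberTmul c (m + m') = fiberTmul c m + fiberTmul c m' :=
  TensorProduct.tmul_add c m m'

theorem fiberRing_smul_tmul (c c' : p.asIdeal.ResidueField) (a : A) (m : M) :
    (c ⊗ₜ[R] a : fiberRing p A) • fiberTmul c' m = fiberTmul (c * c') (a • m) :=
  rfl

theorem isNoetherianRing_fiberRing [IsNoetherianRing A] : IsNoetherianRing (fiberRing p A) := by
  have : IsNoetherianRing (A ⊗[R] p.asIdeal.ResidueField) :=
    Algebra.EssFiniteType.isNoetherianRing A _
  exact isNoetherianRing_of_ringEquiv _
    (Algebra.TensorProduct.comm R A p.asIdeal.ResidueField).toRingEquiv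

theorem finite_fiberModule [Module.Finite A M] :
    Module.Finite (fiberRing p A) (fiberModule p M) := by
  obtain ⟨s, hs⟩ := Module.Finite.fg_top (R := A) (M := M)
  let ι : M → fiberModule p M := fiberTmul 1
  classical
  refine ⟨⟨s.image ι, eq_top_iff.2 ?_⟩⟩
  rintro x -
  have h₁ : ∀ m : M, ι m ∈ Submodule.span (fiberRing p A) ((s.image ι : Finset _) : Set _) := by
    intro m
    have hm : m ∈ Submodule.span A (s : Set M) := hs ▸ Submodule.mem_top
    induction hm using Submodule.span_induction with
    | mem m hm => exact Submodule.subset_span (Finset.mem_image_of_mem ι hm)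
    | zero =>
      have : ι 0 = 0 := TensorProduct.tmul_zero _ _
      rw [this]; exact zero_mem _
    | add m m' _ _ hm hm' =>
      have : ι (m + m') = ι m + ι m' := fiberTmul_add _ _ _ _
      rw [this]; exact add_mem hm hm'
    | smul a m _ hm =>
      have : ι (a • m) = ((1 : p.asIdeal.ResidueField) ⊗ₜ[R] a : fiberRing p A) • ι m := by
        rw [fiberRing_smul_tmul, mul_one]
      rw [this]; exact Submodule.smul_mem _ _ hm
  refine fiberModule_induction x (zero_mem _) (fun c m => ?_) fun y z hy hz => add_mem hy hz
  have : fiberTmul c m = (c ⊗ₜ[R] (1 : A) : fiberRing p A) • ι m := by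
    rw [fiberRing_smul_tmul, mul_one, one_smul]
  rw [this]
  exact Submodule.smul_mem _ _ (h₁ m)

theorem range_lTensor_eq_fiberIdeal_pow_smul_top (I : Ideal A) (n : ℕ) :
    (LinearMap.range (TensorProduct.AlgebraTensorModule.lTensor p.asIdeal.ResidueField
      p.asIdeal.ResidueField ((I ^ n • ⊤ : Submodule A M).subtype.restrictScalars R)) :
        Submodule p.asIdeal.ResidueField (fiberModule p M)) =
      (fiberIdeal p I ^ n • ⊤ : Submodule (fiberRing p A) (fiberModule p M)).restrictScalars
        p.asIdeal.ResidueField := by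
  have hpow : fiberIdeal p I ^ n = (I ^ n).map
      (Algebra.TensorProduct.includeRight : A →ₐ[R] fiberRing p A) := (Ideal.map_pow _ _ _).symm
  rw [hpow]
  apply le_antisymm
  · let L : p.asIdeal.ResidueField ⊗[R] (I ^ n • ⊤ : Submodule A M) →ₗ[p.asIdeal.ResidueField]
        fiberModule p M := TensorProduct.AlgebraTensorModule.lTensor p.asIdeal.ResidueField
      p.asIdeal.ResidueField ((I ^ n • ⊤ : Submodule A M).subtype.restrictScalars R)
    rintro _ ⟨x, rfl⟩
    change L x ∈ _
    induction x using TensorProduct.induction_on with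
    | zero => rw [map_zero]; exact zero_mem _
    | add x y hx hy => rw [map_add]; exact add_mem hx hy
    | tmul c x =>
      obtain ⟨x, hx⟩ := x
      change fiberTmul c x ∈ Submodule.restrictScalars _ _
      rw [Submodule.restrictScalars_mem]
      induction hx using Submodule.smul_induction_on' with
      | smul a ha m _ =>
        have h₁ := fiberRing_smul_tmul p 1 c a m
        rw [one_mul] at h₁
        rw [← h₁]
        exact Submodule.smul_mem_smul (Ideal.mem_map_of_mem _ ha) Submodule.mem_top
      | add x _ y _ hx hy =>
        rw [fiberTmul_add]
        exact add_mem hx hy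
  · intro x hx
    rw [Submodule.restrictScalars_mem] at hx
    induction hx using Submodule.smul_induction_on' with
    | add x _ y _ hx hy => exact add_mem hx hy
    | smul j hj y _ =>
      induction hj using Submodule.span_induction generalizing y with
      | zero => rw [zero_smul]; exact zero_mem _
      | add j j' _ _ hj hj' => rw [add_smul]; exact add_mem (hj y trivial) (hj' y trivial)
      | smul b j _ hj => rw [smul_eq_mul, mul_comm, mul_smul]; exact hj (b • y) trivial
      | mem j hj =>
        obtain ⟨a, ha, rfl⟩ := hj
        refine fiberModule_induction y ?_ (fun c m => ?_) fun y z hy hz => ?_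
        · rw [smul_zero]; exact zero_mem _
        · refine ⟨c ⊗ₜ[R] ⟨a • m, Submodule.smul_mem_smul ha Submodule.mem_top⟩, ?_⟩
          refine Eq.trans ?_ (fiberRing_smul_tmul p 1 c a m).symm
          rw [one_mul]
          rfl
        · rw [smul_add]; exact add_mem hy hz

/-- The fibre of `M / IⁿM` is `M(p) / IⁿM(p)`. -/
noncomputable def fiberQuotientEquiv (I : Ideal A) (n : ℕ) :
    p.asIdeal.ResidueField ⊗[R] (M ⧸ (I ^ n • ⊤ : Submodule A M)) ≃ₗ[p.asIdeal.ResidueField]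
      fiberModule p M ⧸ (fiberIdeal p I ^ n • ⊤ : Submodule (fiberRing p A) (fiberModule p M)) :=
  (TensorProduct.AlgebraTensorModule.tensorQuotientEquiv (R := R) p.asIdeal.ResidueField A
    p.asIdeal.ResidueField (I ^ n • ⊤ : Submodule A M)).trans <|
  (Submodule.quotEquivOfEq _ _ (range_lTensor_eq_fiberIdeal_pow_smul_top p I n)).trans
    (Submodule.Quotient.restrictScalarsEquiv _ _)

end Fiber

/-- Let `i` be the first index where `F x` and `y` differ. Near `x` the terms up to `i` do not
increase, so the first one that changes, if any, only makes the sequence smaller. -/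
theorem upperSemicontinuous_toLex {X : Type*} [TopologicalSpace X] {F : X → ℕ → ℕ}
    (hF : ∀ i, UpperSemicontinuous fun x => F x i) :
    UpperSemicontinuous fun x => (toLex (F x) : Lex (ℕ → ℕ)) := by
  intro x y hy
  obtain ⟨i, hi, hlt⟩ := hy
  have h₁ : ∀ᶠ x' in nhds x, ∀ j ∈ Finset.range (i + 1), F x' j ≤ F x j :=
    (Filter.eventually_all_finset _).2 fun j _ =>
      (hF j x (F x j + 1) (Nat.lt_succ_self _)).mono fun _ h => Nat.lt_succ_iff.1 h
  filter_upwards [h₁] with x' hx'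
  by_cases hex : ∃ j, j ≤ i ∧ F x' j ≠ F x j
  · classical
    obtain ⟨hj, hne⟩ := Nat.find_spec hex
    set j := Nat.find hex
    have hlt' : F x' j < F x j := lt_of_le_of_ne (hx' j (Finset.mem_range_succ_iff.2 hj)) hne
    refine ⟨j, fun k hk => ?_, ?_⟩
    · have hk' : F x' k = F x k := by
        by_contra hne'
        exact Nat.find_min hex hk ⟨hk.le.trans hj, hne'⟩
      exact hk'.trans (hi k (hk.trans_le hj))
    · rcases hj.lt_or_eq with h | h
      · exact hlt'.trans_eq (hi j h)
      · exact hlt'.trans (by rw [h]; exact hlt)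
  · push Not at hex
    exact ⟨i, fun k hk => (hex k hk.le).trans (hi k hk), (hex i le_rfl).trans_lt hlt⟩

theorem finrank_tensorProduct_eq_of_surjective {R K Q Q' : Type*} [CommRing R] [Field K]
    [Algebra R K] [AddCommGroup Q] [Module R Q] [AddCommGroup Q'] [Module R Q'] {φ : Q →ₗ[R] Q'}
    (hφ : Function.Surjective φ) (hker : ∀ x, φ x = 0 → ∀ c : K, c ⊗ₜ[R] x = 0) :
    Module.finrank K (K ⊗[R] Q) = Module.finrank K (K ⊗[R] Q') := by
  have hex := lTensor_exact K (LinearMap.exact_subtype_ker_map φ) hφ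
  refine (LinearEquiv.ofBijective (φ.baseChange K)
    ⟨?_, LinearMap.lTensor_surjective K hφ⟩).finrank_eq
  rw [injective_iff_map_eq_zero]
  intro x hx
  obtain ⟨y, rfl⟩ := (hex x).1 hx
  induction y using TensorProduct.induction_on with
  | zero => rw [map_zero]
  | tmul c y => exact hker _ y.2 c
  | add y z hy hz =>
    rw [map_add, hy ((hex _).2 ⟨y, rfl⟩), hz ((hex _).2 ⟨z, rfl⟩), add_zero]

/-! ### Hilbert–Samuel functions and multiplicities of the fibres -/

section

variable {R A M : Type*} [CommRing R] [CommRing A] [Algebra R A] [AddCommGroup M] [Module R M]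
  [Module A M] [IsScalarTower R A M]

theorem hsFunction_fiber_eq (p : PrimeSpectrum R) (I : Ideal A) (n : ℕ) :
    hsFunction p.asIdeal.ResidueField (fiberIdeal p I) (fiberModule p M) n =
      Module.finrank p.asIdeal.ResidueField
        (p.asIdeal.ResidueField ⊗[R] (M ⧸ (I ^ n • ⊤ : Submodule A M))) :=
  (fiberQuotientEquiv p I n).finrank_eq.symm

theorem tmul_mk_eq_zero_of_mem {p : PrimeSpectrum R} {q : Ideal R} (hqp : q ≤ p.asIdeal)
    (N : Submodule A M) {x : M} (hx : x ∈ q.map (algebraMap R A) • (⊤ : Submodule A M))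
    (c : p.asIdeal.ResidueField) : c ⊗ₜ[R] (Submodule.Quotient.mk x : M ⧸ N) = 0 := by
  induction hx using Submodule.smul_induction_on' with
  | add x _ y _ hx hy =>
    rw [Submodule.Quotient.mk_add, TensorProduct.tmul_add, hx, hy, add_zero]
  | smul j hj y _ =>
    induction hj using Submodule.span_induction generalizing y with
    | zero => rw [zero_smul, Submodule.Quotient.mk_zero, TensorProduct.tmul_zero]
    | add j j' _ _ hj hj' =>
      rw [add_smul, Submodule.Quotient.mk_add, TensorProduct.tmul_add, hj y trivial, hj' y trivial,
        add_zero]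
    | smul b j _ hj => rw [smul_eq_mul, mul_comm, mul_smul]; exact hj (b • y) trivial
    | mem j hj =>
      obtain ⟨r, hr, rfl⟩ := hj
      rw [algebraMap_smul, Submodule.Quotient.mk_smul, ← TensorProduct.smul_tmul,
        Algebra.smul_def, Ideal.algebraMap_residueField_eq_zero.2 (hqp hr), zero_mul,
        TensorProduct.zero_tmul]

/-- For `p ≥ q`, replacing `M` by `M/qM` does not change the fibre at `p`, and over `M/qM` uniform
generic freeness applies. -/
theorem exists_hsFunction_fiber_eq [IsNoetherianRing R] [IsNoetherianRing A] (I : Ideal A)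
    [Module.Finite R (A ⧸ I)] [Module.Finite A M] (q : PrimeSpectrum R) :
    ∃ f ∉ q.asIdeal, ∃ h : ℕ → ℕ, EventuallyPolynomial h ∧ ∀ p : PrimeSpectrum R, q ≤ p →
      f ∉ p.asIdeal → ∀ n,
        hsFunction p.asIdeal.ResidueField (fiberIdeal p I) (fiberModule p M) n = h n := by
  let Z : Submodule A M := q.asIdeal.map (algebraMap R A) • ⊤
  have hqM : ∀ r ∈ q.asIdeal, ∀ x : M ⧸ Z, r • x = 0 := fun r hr x => by
    obtain ⟨x, rfl⟩ := Submodule.Quotient.mk_surjective _ x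
    rw [← Submodule.Quotient.mk_smul, Submodule.Quotient.mk_eq_zero, ← algebraMap_smul A]
    exact Submodule.smul_mem_smul (Ideal.mem_map_of_mem _ hr) Submodule.mem_top
  obtain ⟨f, hf, h, hh, H⟩ := exists_genericallyFree_pow_smul_top I q.asIdeal hqM
  refine ⟨f, hf, h, hh, fun p hqp hfp n => ?_⟩
  have hmap : (I ^ n • ⊤ : Submodule A M).map Z.mkQ = I ^ n • ⊤ := by
    rw [Submodule.map_smul'', Submodule.map_top, Submodule.range_mkQ]
  let φ : (M ⧸ (I ^ n • ⊤ : Submodule A M)) →ₗ[R]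
      ((M ⧸ Z) ⧸ (I ^ n • ⊤ : Submodule A (M ⧸ Z))) :=
    (Submodule.mapQ _ _ Z.mkQ (Submodule.map_le_iff_le_comap.1 hmap.le)).restrictScalars R
  have hφ : Function.Surjective φ := fun y => by
    obtain ⟨y, rfl⟩ := Submodule.Quotient.mk_surjective _ y
    obtain ⟨y, rfl⟩ := Submodule.Quotient.mk_surjective _ y
    exact ⟨Submodule.Quotient.mk y, rfl⟩
  rw [hsFunction_fiber_eq, finrank_tensorProduct_eq_of_surjective hφ fun x hx c => ?_]
  · have := finite_quotient_pow_smul_top R I (M ⧸ Z) n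
    refine GenericallyFree.finrank_eq (q := q.asIdeal) (f := f) ?_ p hqp hfp
    have H' := (H n).map ((I ^ n • ⊤ : Submodule A (M ⧸ Z)).mkQ.restrictScalars R) (U' := ⊥)
      (fun x hx => (Submodule.Quotient.mk_eq_zero _).2 hx)
      fun x _ hx => (Submodule.Quotient.mk_eq_zero _).1 hx
    have hr : LinearMap.range ((I ^ n • ⊤ : Submodule A (M ⧸ Z)).mkQ.restrictScalars R) = ⊤ :=
      LinearMap.range_eq_top.2 (Submodule.mkQ_surjective (I ^ n • ⊤ : Submodule A (M ⧸ Z)))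
    rwa [bot_sup_eq, Submodule.map_top, hr] at H'
  · obtain ⟨x, rfl⟩ := Submodule.Quotient.mk_surjective _ x
    have hx' : Z.mkQ x ∈ (I ^ n • ⊤ : Submodule A (M ⧸ Z)) :=
      (Submodule.Quotient.mk_eq_zero _).1 hx
    rw [← hmap] at hx'
    obtain ⟨y, hy, hyx⟩ := hx'
    have hxy : x - y ∈ Z := (Submodule.Quotient.eq Z).1 hyx.symm
    have hmk : (Submodule.Quotient.mk x : M ⧸ (I ^ n • ⊤ : Submodule A M)) =
        Submodule.Quotient.mk (x - y) := by
      rw [Submodule.Quotient.eq]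
      simpa using hy
    rw [hmk]
    exact tmul_mk_eq_zero_of_mem hqp _ hxy c

theorem hsFunction_fiber_le_of_le [IsNoetherianRing A] (I : Ideal A)
    [Module.Finite R (A ⧸ I)] [Module.Finite A M] {q p : PrimeSpectrum R} (hqp : q ≤ p) (n : ℕ) :
    hsFunction q.asIdeal.ResidueField (fiberIdeal q I) (fiberModule q M) n ≤
      hsFunction p.asIdeal.ResidueField (fiberIdeal p I) (fiberModule p M) n := by
  have := finite_quotient_pow_smul_top R I M n
  rw [hsFunction_fiber_eq, hsFunction_fiber_eq]
  obtain ⟨f, hf, h⟩ := exists_finrank_le (R := R) (Q := M ⧸ (I ^ n • ⊤ : Submodule A M)) p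
  exact h q fun hfq => hf (hqp hfq)

theorem finite_fiberRing_quotient (I : Ideal A) [Module.Finite R (A ⧸ I)] (p : PrimeSpectrum R) :
    Module.Finite p.asIdeal.ResidueField (fiberRing p A ⧸ fiberIdeal p I) :=
  Module.Finite.equiv (Algebra.TensorProduct.tensorQuotientEquiv (R := R)
    p.asIdeal.ResidueField A p.asIdeal.ResidueField I).toLinearEquiv

/-- The constancy result with `q = p` makes the function of the fibre at `p` itself eventually
polynomial; the growth bound then yields the limit. -/
theorem tendsto_hsTerm_fiber [IsNoetherianRing R] [IsNoetherianRing A] (I : Ideal A)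
    [Module.Finite R (A ⧸ I)] [Module.Finite A M] (p : PrimeSpectrum R) {d : ℕ}
    (hd : Module.supportDim (fiberRing p A) (fiberModule p M) = d) :
    Filter.Tendsto (hsTerm p.asIdeal.ResidueField (fiberIdeal p I) (fiberModule p M)) Filter.atTop
      (nhds (hsMultiplicity p.asIdeal.ResidueField (fiberIdeal p I) (fiberModule p M))) := by
  have := isNoetherianRing_fiberRing (A := A) p
  have := finite_fiberRing_quotient I p
  have := finite_fiberModule (A := A) (M := M) p
  obtain ⟨f, hf, h, hh, H⟩ := exists_hsFunction_fiber_eq (M := M) I p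
  obtain ⟨c, hc⟩ := exists_hsFunction_le (K := p.asIdeal.ResidueField) (J := fiberIdeal p I) d
    (fiberModule p M) hd.le
  obtain ⟨e, he⟩ := hh.exists_tendsto (d := d) (c := c) fun n => by
    rw [← H p le_rfl hf n]
    exact_mod_cast hc n
  refine tendsto_nhds_limUnder ⟨(Nat.factorial d : ℝ) * e, (he.const_mul _).congr fun n => ?_⟩
  have hdim : natDim (fiberRing p A) (fiberModule p M) = d := by
    rw [natDim, hd]; rfl
  rw [hsTerm, hdim, H p le_rfl hf n, mul_div_assoc]

theorem upperSemicontinuous_hsMultiplicity_fiber [IsNoetherianRing R] [IsNoetherianRing A]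
    (I : Ideal A) [Module.Finite R (A ⧸ I)] [Module.Finite A M] {d : ℕ}
    (hd : ∀ p : PrimeSpectrum R, Module.supportDim (fiberRing p A) (fiberModule p M) = d) :
    UpperSemicontinuous fun p : PrimeSpectrum R =>
      hsMultiplicity p.asIdeal.ResidueField (fiberIdeal p I) (fiberModule p M) := by
  have hdim : ∀ p : PrimeSpectrum R, natDim (fiberRing p A) (fiberModule p M) = d := fun p => by
    rw [natDim, hd]; rfl
  rw [upperSemicontinuous_iff_isOpen_preimage]
  refine fun y => isOpen_of_forall_le_of_forall_exists (fun q p hqp hp => ?_) fun q hq => ?_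
  -- Because `d` is common to all fibres, the termwise inequality under generization passes to the
  -- limits.
  · rw [Set.mem_preimage, Set.mem_Iio] at hp ⊢
    refine lt_of_le_of_lt ?_ hp
    refine le_of_tendsto_of_tendsto' (tendsto_hsTerm_fiber I q (hd q))
      (tendsto_hsTerm_fiber I p (hd p)) fun n => ?_
    rw [hsTerm, hsTerm, hdim, hdim]
    gcongr
    exact hsFunction_fiber_le_of_le I hqp n
  · obtain ⟨f, hf, h, -, H⟩ := exists_hsFunction_fiber_eq (M := M) I q
    refine ⟨f, hf, fun p hqp hfp => ?_⟩
    have heq : hsTerm p.asIdeal.ResidueField (fiberIdeal p I) (fiberModule p M) =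
        hsTerm q.asIdeal.ResidueField (fiberIdeal q I) (fiberModule q M) := funext fun n => by
      rw [hsTerm, hsTerm, hdim, hdim, H p hqp hfp, H q le_rfl hf]
    rw [Set.mem_preimage, hsMultiplicity, heq]
    exact hq

end

end HilbertSamuel

theorem mainTheorem2 {R A M : Type*} [CommRing R] [IsNoetherianRing R]
    [CommRing A] [IsNoetherianRing A] [Algebra R A]
    (I : Ideal A) [Module.Finite R (A ⧸ I)]
    [AddCommGroup M] [Module R M] [Module A M] [IsScalarTower R A M] [Module.Finite A M] :
    -- the fibrewise quotients `M(p) / IⁿM(p)` are finite-dimensional over `k(p)`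
    (∀ (p : PrimeSpectrum R) (n : ℕ), Module.Finite p.asIdeal.ResidueField
      (fiberModule p M ⧸
        (fiberIdeal p I ^ n • ⊤ : Submodule (fiberRing p A) (fiberModule p M)))) ∧
    -- each term of the Hilbert–Samuel function is upper semicontinuous
    (∀ n : ℕ, UpperSemicontinuous fun p : PrimeSpectrum R =>
      hsFunction p.asIdeal.ResidueField (fiberIdeal p I) (fiberModule p M) n) ∧
    -- so is the sequence of its terms for `n = 1, 2, …`, in the lexicographic order
    (UpperSemicontinuous fun p : PrimeSpectrum R =>
      (toLex fun i : ℕ =>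
        hsFunction p.asIdeal.ResidueField (fiberIdeal p I) (fiberModule p M) (i + 1) :
          Lex (ℕ → ℕ))) ∧
    -- if all fibres `M(p)` have the same dimension, then so is the Hilbert–Samuel multiplicity
    (∀ d : ℕ,
      (∀ p : PrimeSpectrum R, Module.supportDim (fiberRing p A) (fiberModule p M) = d) →
      (∀ p : PrimeSpectrum R, Filter.Tendsto
        (hsTerm p.asIdeal.ResidueField (fiberIdeal p I) (fiberModule p M)) Filter.atTop
        (nhds (hsMultiplicity p.asIdeal.ResidueField (fiberIdeal p I) (fiberModule p M)))) ∧
      UpperSemicontinuous fun p : PrimeSpectrum R =>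
        hsMultiplicity p.asIdeal.ResidueField (fiberIdeal p I) (fiberModule p M)) := by
  have hfin := fun n => finite_quotient_pow_smul_top R I M n
  have husc : ∀ n : ℕ, UpperSemicontinuous fun p : PrimeSpectrum R =>
      hsFunction p.asIdeal.ResidueField (fiberIdeal p I) (fiberModule p M) n := fun n => by
    have := hfin n
    simp only [hsFunction_fiber_eq]
    exact upperSemicontinuous_finrank
  refine ⟨fun p n => ?_, husc, upperSemicontinuous_toLex fun i => husc (i + 1), fun d hd =>
    ⟨fun p => tendsto_hsTerm_fiber I p (hd p), upperSemicontinuous_hsMultiplicity_fiber I hd⟩⟩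
  have := hfin n
  exact Module.Finite.equiv (fiberQuotientEquiv p I n)
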